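/- Let $T$ be a caterpillar with at least two vertices, i.e. a finite tree such that deleting all its pendant vertices (vertices of degree $1$) leaves a path (possibly with no vertices). For $R\subseteq V(T)$ let $R_0=R$ and let $R_{t+1}$ be $R_t$ together with all vertices having at least two neighbours in $R_t$. A set $S$ is $P_3$-convex if every vertex outside $S$ has at most one neighbour in $S$; $R$ is a hull set if the smallest $P_3$-convex set containing $R$ is $V(T)$; in that case $\tau_R(T)$ is the least $t$ with $R_t=V(T)$. The percolation time is $\tau(T)=\max\{\tau_R(T): R \text{ a hull set of } T\}$. $T$ has a dominating path whose two endpoints are distinct leaves (every vertex not on the path has a neighbour on it). Let $v_1,\dots,v_k$ be any such path and put $d_i=\min\{\deg_T(v_i),4\}$. Define $\ell(1)=1$ and, for $i\ge 2$, $\ell(i)=\ell(i-1)$ if $d_i=d_{i-1}=3$, and $\ell(i)=\ell(i-1)+1$ otherwise. Let $n(i)$ and $m(i)$ be the least and the greatest $j\in\{1,\dots,k\}$ with $\ell(j)=\ell(i)$. Define $f_1,\dots,f_k$ as follows. - If $d_i=1$, then $f_i=0$. If $d_i=4$, then $f_i=1$. - If $d_i=3$, let $x=i-n(i)$, $y=m(i)-i$,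 $a=d_{n(i)-1}$, $b=d_{m(i)+1}$. Then $$f_i=\begin{cases}\min\{x,y\}+1&(a,b)=(1,1)\\ \max\{x,y\}+1&(a,b)=(2,2)\\ x+1&(a,b)=(1,2)\\ y+1&(a,b)=(2,1)\\ \min\{x+1,y+2\}&(a,b)=(1,4)\\ \min\{x+2,y+1\}&(a,b)=(4,1)\\ x+2&(a,b)=(4,2)\\ y+2&(a,b)=(2,4)\\ \min\{x,y\}+2&(a,b)=(4,4).\end{cases}$$ - If $d_i=2$, then $f_i=1$ if $d_{i-1},d_{i+1}\in\{1,2\}$; $f_i=f_{i+1}+1$ if $d_{i-1}\in\{1,2\}$ and $d_{i+1}\notin\{1,2\}$; $f_i=f_{i-1}+1$ if $d_{i-1}\notin\{1,2\}$ and $d_{i+1}\in\{1,2\}$; $f_i=\max\{f_{i-1},f_{i+1}\}+1$ if $d_{i-1},d_{i+1}\notin\{1,2\}$. Then, with $F(T)=\max_{1\le i\le k}f_i$, we have $\tau(T)=F(T)$. -/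

import Mathlib

/-- A caterpillar: a tree such that the removal of all its pendant vertices yields a path
(possibly the path with no vertices, as happens for the tree with a single edge). -/
def IsCaterpillar {V : Type*} [Fintype V] (G : SimpleGraph V) [DecidableRel G.Adj] : Prop :=
  G.IsTree ∧
    ∃ n : ℕ, Nonempty (G.induce {v : V | G.degree v ≠ 1} ≃g SimpleGraph.pathGraph n)

/-- `S` is convex in the convexity generated by the paths of length two. -/
def IsP3Convex {V : Type*} (G : SimpleGraph V) (S : Set V) : Prop :=
  ∀ u v w : V, u ≠ w → G.Adj u v → G.Adj v w → u ∈ S → w ∈ S → v ∈ S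

/-- The smallest convex set containing `R`. -/
def p3Hull {V : Type*} (G : SimpleGraph V) (R : Set V) : Set V :=
  ⋂₀ {S : Set V | IsP3Convex G S ∧ R ⊆ S}

/-- `R` percolates `G`, i.e. `R` is a hull set of `G`. -/
def IsP3HullSet {V : Type*} (G : SimpleGraph V) (R : Set V) : Prop :=
  p3Hull G R = Set.univ

/-- One step of the process: add to `S` all the vertices with at least two neighbours in `S`. -/
def p3Interval {V : Type*} (G : SimpleGraph V) (S : Set V) : Set V :=
  S ∪ {v : V | ∃ u w : V, u ≠ w ∧ G.Adj v u ∧ G.Adj v w ∧ u ∈ S ∧ w ∈ S}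

/-- The sets `R_0 = R`, `R_1`, `R_2`, … of the percolation process started at `R`. -/
def percolationStep {V : Type*} (G : SimpleGraph V) (R : Set V) : ℕ → Set V
  | 0 => R
  | t + 1 => p3Interval G (percolationStep G R t)

/-- The least `t` with `R_t = V(G)`, for a hull set `R` of a finite graph. -/
noncomputable def hullSetTime {V : Type*} (G : SimpleGraph V) (R : Set V) : ℕ :=
  sInf {t : ℕ | percolationStep G R t = Set.univ}

/-- The percolation time: the maximum of `hullSetTime G R` over all the hull sets `R`. (For a
finite graph this is a finite nonempty set of values, since `V(G)` itself is a hull set.) -/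
noncomputable def percolationTime {V : Type*} (G : SimpleGraph V) : ℕ :=
  sSup {t : ℕ | ∃ R : Set V, IsP3HullSet G R ∧ t = hullSetTime G R}

/-- `P` is a dominating path whose two endpoints are leaves. -/
def IsLeafDominatingPath {V : Type*} [Fintype V] (G : SimpleGraph V) [DecidableRel G.Adj]
    {a b : V} (P : G.Walk a b) : Prop :=
  P.IsPath ∧ a ≠ b ∧ G.degree a = 1 ∧ G.degree b = 1 ∧
    ∀ v : V, v ∉ P.support → ∃ w ∈ P.support, G.Adj v w

/-- The sequence of the reduced degrees `min (deg v) 4` along the vertices of a walk. -/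
def reducedDegreeSequence {V : Type*} [Fintype V] (G : SimpleGraph V) [DecidableRel G.Adj]
    {a b : V} (P : G.Walk a b) : List ℕ :=
  P.support.map fun v => min (G.degree v) 4

namespace PercolationSequence

/-! Below, `s` is a reduced degree sequence; its terms are indexed from `0`. -/

/-- The `i`-th term of `s`. -/
def term (s : List ℕ) (i : ℕ) : ℕ := s.getD i 0

/-- The labels `ℓ(i)`: constant on each maximal block of consecutive terms equal to `3`,
increasing by one at every other step. -/
def label (s : List ℕ) : ℕ → ℕ
  | 0 => 1
  | i + 1 =>
    if term s (i + 1) ≠ 3 ∨ (term s (i + 1) = 3 ∧ term s i ≠ 3) then label s i + 1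
    else label s i

/-- `n(i)`: the least index with the same label as `i`. -/
def first (s : List ℕ) (i : ℕ) : ℕ :=
  Nat.find (p := fun j => label s j = label s i) ⟨i, rfl⟩

/-- `m(i)`: the greatest index of `s` with the same label as `i`. -/
def last (s : List ℕ) (i : ℕ) : ℕ :=
  Nat.findGreatest (fun j => label s j = label s i) (s.length - 1)

/-- The value of the percolation sequence at an index `i` of a block of terms equal to `3`,
according to the terms just before and just after the block. -/
def blockValue (s : List ℕ) (i : ℕ) : ℕ :=
  let x := i - first s i
  let y := last s i - i
  match term s (first s i - 1), term s (last s i + 1) with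
  | 1, 1 => min x y + 1
  | 2, 2 => max x y + 1
  | 1, 2 => x + 1
  | 2, 1 => y + 1
  | 1, 4 => min (x + 1) (y + 2)
  | 4, 1 => min (x + 2) (y + 1)
  | 4, 2 => x + 2
  | 2, 4 => y + 2
  | 4, 4 => min x y + 2
  | _, _ => 0

/-- The percolation sequence at the indices whose term is `1`, `3` or `4`. -/
def baseValue (s : List ℕ) (i : ℕ) : ℕ :=
  match term s i with
  | 1 => 0
  | 3 => blockValue s i
  | 4 => 1
  | _ => 0

/-- The percolation sequence. At an index `i` with term `2`, only neighbouring indices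
with term `3` or `4` are referred to, and there the sequence is given by `baseValue`. -/
def value (s : List ℕ) (i : ℕ) : ℕ :=
  if term s i = 2 then
    if term s (i - 1) ∈ ({1, 2} : Finset ℕ) then
      if term s (i + 1) ∈ ({1, 2} : Finset ℕ) then 1
      else baseValue s (i + 1) + 1
    else
      if term s (i + 1) ∈ ({1, 2} : Finset ℕ) then baseValue s (i - 1) + 1
      else max (baseValue s (i - 1)) (baseValue s (i + 1)) + 1
  else baseValue s i

/-- The maximum entry of the percolation sequence. -/
def maxValue (s : List ℕ) : ℕ := (Finset.range s.length).sup (value s)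

end PercolationSequence

/-! A percolation from a hull set is encoded by the arrival times of the vertices, and
`IsTimeFunction` characterises these functions locally. The percolation time is therefore the
largest value taken by a time function.

In a tree, every vertex off a leaf dominating path is a leaf, so its time is 0: a positive time
needs two earlier neighbours. Only the times along the path remain, and the local conditions depend
only on the reduced degrees (`IsTimeSequence`). A positive time at a 2 exceeds both neighbouring
times, and one of them by exactly 1. A 3 has one leaf at time 0, so a positive time exceeds some
neighbouring time and each of them by at most 1. A 4 has two leaves at time 0, so its time is at
most 1. Conversely, a time sequence extends by 0 to a time function.

The entry of the percolation sequence at each index is the largest time possible there. For the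
upper bound (`IsTimeSequence.le_value`), times grow by at most 1 per step into a block of 3s from
either end. A 4 or a leaf at an end bounds the start; between two 2s, some time is 0. The bound is
attained (`exists_value_le`) by tents and ramps supported on a single block and its two ends; the
witness may vary with the index, since only a maximum is sought. -/

/-- A function assigning to each vertex the time at which it is reached in some percolation. -/
def IsTimeFunction {V : Type*} (G : SimpleGraph V) (t : V → ℕ) : Prop :=
  ∀ v, 0 < t v →
    (∃ u w, u ≠ w ∧ G.Adj v u ∧ G.Adj v w ∧ t u < t v ∧ t w < t v) ∧
    ∀ u w, u ≠ w → G.Adj v u → G.Adj v w → t v ≤ max (t u) (t w) + 1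

/-! ### Hull sets as time functions -/

section Percolation

variable {V : Type*} {G : SimpleGraph V}

theorem percolationStep_mono (R : Set V) : Monotone (percolationStep G R) :=
  monotone_nat_of_le_succ fun _ => Set.subset_union_left

/-- The two clauses of `IsTimeFunction` give the two inclusions: two neighbours reached by time `s`
force time at most `s + 1`, and a positive time is always caused by two earlier neighbours. -/
theorem IsTimeFunction.percolationStep_eq {t : V → ℕ} (ht : IsTimeFunction G t) (s : ℕ) :
    percolationStep G {v | t v = 0} s = {v | t v ≤ s} := by
  induction s with
  | zero => simp [percolationStep]
  | succ s ih =>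
    rw [percolationStep, ih]
    ext v
    simp only [p3Interval, Set.mem_union, Set.mem_ofPred_eq]
    constructor
    · rintro (h | ⟨u, w, huw, hu, hw, hus, hws⟩)
      · omega
      · rcases Nat.eq_zero_or_pos (t v) with h | h
        · omega
        · have := (ht v h).2 u w huw hu hw
          omega
    · intro h
      rcases Nat.eq_zero_or_pos (t v) with h0 | h0
      · left; omega
      · obtain ⟨u, w, huw, hu, hw, h1, h2⟩ := (ht v h0).1
        exact Or.inr ⟨u, w, huw, hu, hw, by omega, by omega⟩

theorem percolationStep_subset_p3Hull (R : Set V) (s : ℕ) :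
    percolationStep G R s ⊆ p3Hull G R := by
  rintro v hv S ⟨hS, hRS⟩
  induction s generalizing v with
  | zero => exact hRS hv
  | succ s ih =>
    rcases hv with hv | ⟨u, w, huw, hu, hw, hus, hws⟩
    · exact ih hv
    · exact hS u v w huw hu.symm hw (ih hus) (ih hws)

/-- The union of all stages is convex, as the stages increase. -/
theorem IsP3HullSet.exists_mem_percolationStep {R : Set V} (hR : IsP3HullSet G R) (v : V) :
    ∃ s, v ∈ percolationStep G R s := by
  have hv : v ∈ p3Hull G R := hR ▸ Set.mem_univ v
  have := hv {v | ∃ s, v ∈ percolationStep G R s} ⟨?_, fun w hw => ⟨0, hw⟩⟩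
  · exact this
  · rintro u v w huw hu hw ⟨s, hs⟩ ⟨s', hs'⟩
    exact ⟨max s s' + 1, Or.inr ⟨u, w, huw, hu.symm, hw,
      percolationStep_mono R (le_max_left _ _) hs, percolationStep_mono R (le_max_right _ _) hs'⟩⟩

theorem IsP3HullSet.exists_isTimeFunction {R : Set V} (hR : IsP3HullSet G R) :
    ∃ t, IsTimeFunction G t ∧ R = {v | t v = 0} := by
  classical
  refine ⟨fun v => Nat.find (hR.exists_mem_percolationStep v), fun v hv => ⟨?_, ?_⟩, ?_⟩
  · have h1 := Nat.find_spec (hR.exists_mem_percolationStep v)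
    dsimp only at hv
    obtain ⟨s, hs⟩ := Nat.exists_eq_add_of_lt hv
    have h2 := Nat.find_min (hR.exists_mem_percolationStep v) (m := s) (by omega)
    simp only [zero_add] at hs
    rw [hs] at h1
    rcases h1 with h1 | ⟨u, w, huw, hu, hw, hus, hws⟩
    · exact absurd h1 h2
    · refine ⟨u, w, huw, hu, hw, ?_, ?_⟩ <;> simp only [hs, Nat.lt_succ_iff]
      · exact Nat.find_min' _ hus
      · exact Nat.find_min' _ hws
  · intro u w huw hu hw
    exact Nat.find_min' _ (Or.inr ⟨u, w, huw, hu, hw,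
      percolationStep_mono R (le_max_left _ _)
        (Nat.find_spec (hR.exists_mem_percolationStep u)),
      percolationStep_mono R (le_max_right _ _)
        (Nat.find_spec (hR.exists_mem_percolationStep w))⟩)
  · ext v
    simp [percolationStep]

theorem percolationTime_le {B : ℕ} (h : ∀ t, IsTimeFunction G t → ∀ v, t v ≤ B) :
    percolationTime G ≤ B := by
  refine csSup_le' ?_
  rintro _ ⟨R, hR, rfl⟩
  obtain ⟨t, ht, rfl⟩ := hR.exists_isTimeFunction
  refine Nat.sInf_le ?_
  simp [ht.percolationStep_eq, h t ht]

theorem IsTimeFunction.le_percolationTime [Finite V] {t : V → ℕ} (ht : IsTimeFunction G t)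
    (v : V) : t v ≤ percolationTime G := by
  obtain ⟨B, hB⟩ := (Set.finite_range t).bddAbove
  have hstep : percolationStep G {v | t v = 0} B = Set.univ := by
    rw [ht.percolationStep_eq]
    exact Set.eq_univ_of_forall fun v => hB ⟨v, rfl⟩
  have hhull : IsP3HullSet G {v | t v = 0} :=
    Set.univ_subset_iff.1 (hstep ▸ percolationStep_subset_p3Hull _ B)
  have hle : t v ≤ hullSetTime G {v | t v = 0} := by
    have hmem : hullSetTime G {v | t v = 0} ∈ {s | percolationStep G {v | t v = 0} s = Set.univ} :=
      Nat.sInf_mem ⟨B, hstep⟩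
    rw [Set.mem_ofPred_eq, ht.percolationStep_eq] at hmem
    exact hmem.ge (Set.mem_univ v)
  -- Boundedness matters because `sSup` of an unbounded set of naturals is 0; here there are only
  -- finitely many sets `R`.
  refine hle.trans (le_csSup ?_ ⟨_, hhull, rfl⟩)
  refine ((Set.finite_range (hullSetTime G)).subset ?_).bddAbove
  rintro _ ⟨R, -, rfl⟩
  exact ⟨R, rfl⟩

end Percolation

/-! ### Times along the path: tents, ramps and upper bounds -/

namespace PercolationSequence

/-- The conditions on the terms of the reduced degree sequence of a leaf dominating path with
`k` vertices. -/
structure IsPathSequence (d : ℕ → ℕ) (k : ℕ) : Prop where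
  two_le : 2 ≤ k
  zero : d 0 = 1
  last : d (k - 1) = 1
  inner : ∀ i, 0 < i → i + 1 < k → d i = 2 ∨ d i = 3 ∨ d i = 4

/-- The restrictions of the time functions of a caterpillar to a leaf dominating path. -/
structure IsTimeSequence (d : ℕ → ℕ) (k : ℕ) (τ : ℕ → ℕ) : Prop where
  zero : τ 0 = 0
  last : τ (k - 1) = 0
  two : ∀ i, 0 < i → i + 1 < k → d i = 2 → 0 < τ i →
    τ (i - 1) < τ i ∧ τ (i + 1) < τ i ∧ τ i ≤ max (τ (i - 1)) (τ (i + 1)) + 1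
  three : ∀ i, 0 < i → i + 1 < k → d i = 3 → 0 < τ i →
    (τ (i - 1) < τ i ∨ τ (i + 1) < τ i) ∧ τ i ≤ τ (i - 1) + 1 ∧ τ i ≤ τ (i + 1) + 1
  four : ∀ i, 0 < i → i + 1 < k → d i = 4 → τ i ≤ 1

variable {d τ : ℕ → ℕ} {k : ℕ}

/-- A tent over a block of 3s has slopes at most 1 and no positive local minimum inside. An end
starts at 1 only if it is a 4, whose two leaves account for that time. -/
theorem isTimeSequence_min (hd : IsPathSequence d k) {p q α β : ℕ} (hpq : p + 1 < q) (hq : q < k)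
    (h3 : ∀ j, p < j → j < q → d j = 3) (hα : α = 0 ∨ α = 1 ∧ d p = 4)
    (hβ : β = 0 ∨ β = 1 ∧ d q = 4) :
    IsTimeSequence d k
      (fun j => if p ≤ j ∧ j ≤ q then min (j + α - p) (q + β - j) else 0) := by
  obtain ⟨hk, h0, hl, hi⟩ := hd
  have hp0 : p = 0 → α = 0 := by rintro rfl; omega
  have hqk : q = k - 1 → β = 0 := by rintro rfl; omega
  constructor
  · grind
  · grind
  · intro i _ _ hdi hpos
    have : ¬ (p < i ∧ i < q) := fun h => by have := h3 i h.1 h.2; omega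
    have : i = p → α = 0 := by rintro rfl; omega
    have : i = q → β = 0 := by rintro rfl; omega
    split_ifs at * <;> omega
  · intro i _ _ hdi hpos
    have : i = p → α = 0 := by rintro rfl; omega
    have : i = q → β = 0 := by rintro rfl; omega
    split_ifs at * <;> omega
  · intro i _ _ hdi
    have : ¬ (p < i ∧ i < q) := fun h => by have := h3 i h.1 h.2; omega
    split_ifs at * <;> omega

/-- A ramp may climb onto a 2 and then drop to 0, because only the larger neighbouring time
constrains a 2 from above. The block may be empty. -/
theorem isTimeSequence_right (hd : IsPathSequence d k) {p q α : ℕ} (hpq : p < q) (hq : q < k)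
    (h3 : ∀ j, p < j → j < q → d j = 3) (hα : α = 0 ∨ α = 1 ∧ d p = 4) (hdq : d q = 2) :
    IsTimeSequence d k (fun j => if p ≤ j ∧ j ≤ q then j + α - p else 0) := by
  obtain ⟨hk, h0, hl, hi⟩ := hd
  have hp0 : p = 0 → α = 0 := by rintro rfl; omega
  have hqk : q ≠ k - 1 := by rintro rfl; omega
  constructor
  · grind
  · grind
  · intro i _ _ hdi hpos
    have : ¬ (p < i ∧ i < q) := fun h => by have := h3 i h.1 h.2; omega
    have : i = p → α = 0 := by rintro rfl; omega
    split_ifs at * <;> omega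
  · intro i _ _ hdi hpos
    have : i = p → α = 0 := by rintro rfl; omega
    have : i ≠ q := by rintro rfl; omega
    split_ifs at * <;> omega
  · intro i _ _ hdi
    have : ¬ (p < i ∧ i < q) := fun h => by have := h3 i h.1 h.2; omega
    have : i ≠ q := by rintro rfl; omega
    split_ifs at * <;> omega

theorem isTimeSequence_left (hd : IsPathSequence d k) {p q β : ℕ} (hpq : p < q) (hq : q < k)
    (h3 : ∀ j, p < j → j < q → d j = 3) (hβ : β = 0 ∨ β = 1 ∧ d q = 4) (hdp : d p = 2) :
    IsTimeSequence d k (fun j => if p ≤ j ∧ j ≤ q then q + β - j else 0) := by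
  obtain ⟨hk, h0, hl, hi⟩ := hd
  have hp0 : p ≠ 0 := by rintro rfl; omega
  have hqk : q = k - 1 → β = 0 := by rintro rfl; omega
  constructor
  · grind
  · grind
  · intro i _ _ hdi hpos
    have : ¬ (p < i ∧ i < q) := fun h => by have := h3 i h.1 h.2; omega
    have : i = q → β = 0 := by rintro rfl; omega
    split_ifs at * <;> omega
  · intro i _ _ hdi hpos
    have : i = q → β = 0 := by rintro rfl; omega
    have : i ≠ p := by rintro rfl; omega
    split_ifs at * <;> omega
  · intro i _ _ hdi
    have : ¬ (p < i ∧ i < q) := fun h => by have := h3 i h.1 h.2; omega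
    have : i ≠ p := by rintro rfl; omega
    split_ifs at * <;> omega

namespace IsTimeSequence

theorem le_add_left (hτ : IsTimeSequence d k τ) {p q : ℕ} (hq : q < k)
    (h3 : ∀ j, p < j → j < q → d j = 3) (e : ℕ) (he : p + e < q) : τ (p + e) ≤ τ p + e := by
  induction e with
  | zero => simp
  | succ e ih =>
    have := ih (by omega)
    rcases Nat.eq_zero_or_pos (τ (p + (e + 1))) with h | h
    · omega
    · have := (hτ.three _ (by omega) (by omega) (h3 _ (by omega) he) h).2.1
      rw [show p + (e + 1) - 1 = p + e by omega] at this
      omega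

theorem le_add_right (hτ : IsTimeSequence d k τ) {p q : ℕ} (hq : q < k)
    (h3 : ∀ j, p < j → j < q → d j = 3) (e i : ℕ) (hi : p < i) (he : i + e = q) :
    τ i ≤ τ q + e := by
  induction e generalizing i with
  | zero => subst he; simp
  | succ e ih =>
    have := ih (i + 1) (by omega) (by omega)
    rcases Nat.eq_zero_or_pos (τ i) with h | h
    · omega
    · have := (hτ.three _ (by omega) (by omega) (h3 _ (by omega) (by omega)) h).2.2
      omega

/-- A positive minimum over the closed interval is impossible: a 3 inside has a strictly earlier
path neighbour, and a 2 at an end has an earlier neighbour on the inner side. -/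
theorem exists_eq_zero (hτ : IsTimeSequence d k τ) {p q : ℕ} (hp : 0 < p) (hpq : p < q)
    (hq : q + 1 < k) (h3 : ∀ j, p < j → j < q → d j = 3) (hdp : d p = 2) (hdq : d q = 2) :
    ∃ j, p ≤ j ∧ j ≤ q ∧ τ j = 0 := by
  obtain ⟨j, hj, hmin⟩ := Finset.exists_min_image (Finset.Icc p q) τ ⟨p, by simp [hpq.le]⟩
  rw [Finset.mem_Icc] at hj
  refine ⟨j, hj.1, hj.2, ?_⟩
  by_contra hne
  have hpos : 0 < τ j := Nat.pos_of_ne_zero hne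
  simp only [Finset.mem_Icc] at hmin
  rcases hj.1.eq_or_lt with rfl | h1
  · have := (hτ.two _ hp (by omega) hdp hpos).2.1
    have := hmin (p + 1) (by omega)
    omega
  · rcases hj.2.eq_or_lt with rfl | h2
    · have := (hτ.two _ (by omega) (by omega) hdq hpos).1
      have := hmin (j - 1) (by omega)
      omega
    · have := (hτ.three _ (by omega) (by omega) (h3 j h1 h2) hpos).1
      have := hmin (j - 1) (by omega)
      have := hmin (j + 1) (by omega)
      omega

/-- The zero serves as a new end for a growth bound, and it is no farther from `i` than the end on
its side. -/
theorem block_two_two (hτ : IsTimeSequence d k τ) {p q i : ℕ} (hp : 0 < p)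
    (hq : q + 1 < k) (h3 : ∀ j, p < j → j < q → d j = 3) (hdp : d p = 2) (hdq : d q = 2)
    (hpi : p < i) (hiq : i < q) : τ i ≤ max (i - p) (q - i) := by
  obtain ⟨j, hpj, hjq, hj⟩ := hτ.exists_eq_zero hp (by omega) hq h3 hdp hdq
  rcases le_total j i with h | h
  · have := hτ.le_add_left (p := j) (q := q) (by omega)
      (fun l h1 h2 => h3 l (by omega) h2) (i - j) (by omega)
    rw [Nat.add_sub_cancel' h] at this
    omega
  · have := hτ.le_add_right (p := p) (q := j) (by omega)
      (fun l h1 h2 => h3 l h1 (by omega)) (j - i) i (by omega) (by omega)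
    omega

end IsTimeSequence

end PercolationSequence

/-! ### The percolation sequence as a pointwise maximum -/

namespace PercolationSequence

variable {s : List ℕ}

theorem label_succ (i : ℕ) :
    label s (i + 1) = label s i ∧ term s (i + 1) = 3 ∧ term s i = 3 ∨
      label s (i + 1) = label s i + 1 ∧ ¬(term s (i + 1) = 3 ∧ term s i = 3) := by
  rw [label]
  split_ifs with h <;> simp <;> tauto

theorem label_mono : Monotone (label s) :=
  monotone_nat_of_le_succ fun i => by rcases label_succ (s := s) i with h | h <;> omega

theorem label_eq_of_block {p q i j : ℕ} (h3 : ∀ j, p < j → j < q → term s j = 3)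
    (hpi : p < i) (hij : i ≤ j) (hj : j < q) : label s j = label s i := by
  induction j, hij using Nat.le_induction with
  | base => rfl
  | succ j hij ih =>
    have := ih (by omega)
    have := h3 j (by omega) (by omega)
    have := h3 (j + 1) (by omega) (by omega)
    rcases label_succ (s := s) j with h | h
    · omega
    · exact absurd ⟨by assumption, by assumption⟩ h.2

theorem label_lt_of_ne_three {i j : ℕ} (hij : i < j) (h : term s i ≠ 3 ∨ term s j ≠ 3) :
    label s i < label s j := by
  rcases h with h | h
  · have h1 := label_mono (s := s) (show i + 1 ≤ j from hij)
    rcases label_succ (s := s) i with h2 | h2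
    · exact absurd h2.2.2 h
    · omega
  · obtain ⟨j, rfl⟩ : ∃ l, j = l + 1 := ⟨j - 1, by omega⟩
    have h1 := label_mono (s := s) (show i ≤ j by omega)
    rcases label_succ (s := s) j with h2 | h2
    · exact absurd h2.2.1 h
    · omega

theorem first_eq {p q i : ℕ} (h3 : ∀ j, p < j → j < q → term s j = 3) (hpi : p < i)
    (hiq : i < q) (hp : term s p ≠ 3) : first s i = p + 1 := by
  rw [first, Nat.find_eq_iff]
  refine ⟨(label_eq_of_block h3 (by omega) hpi hiq).symm, fun j hj => ?_⟩
  have h1 := label_lt_of_ne_three (s := s) hpi (Or.inl hp)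
  have h2 := label_mono (s := s) (show j ≤ p by omega)
  omega

theorem last_eq {p q i : ℕ} (h3 : ∀ j, p < j → j < q → term s j = 3) (hpi : p < i)
    (hiq : i < q) (hq : term s q ≠ 3) (hqs : q < s.length) : last s i = q - 1 := by
  rw [last, Nat.findGreatest_eq_iff]
  refine ⟨by omega, fun _ => label_eq_of_block h3 hpi (by omega) (by omega), fun j hj _ h => ?_⟩
  have h1 := label_lt_of_ne_three (s := s) hiq (Or.inr hq)
  have h2 := label_mono (s := s) (show q ≤ j by omega)
  omega

theorem IsPathSequence.exists_block {d : ℕ → ℕ} {k i : ℕ} (hd : IsPathSequence d k)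
    (hi : i < k) (h3 : d i = 3) :
    ∃ p q, p < i ∧ i < q ∧ q < k ∧ (∀ j, p < j → j < q → d j = 3) ∧ d p ≠ 3 ∧ d q ≠ 3 := by
  classical
  obtain ⟨hk, h0, hl, -⟩ := hd
  have hi0 : 0 < i := Nat.pos_of_ne_zero (by rintro rfl; omega)
  have hik : i < k - 1 := lt_of_le_of_ne (by omega) (by rintro rfl; omega)
  have hex : ∃ q, i < q ∧ d q ≠ 3 := ⟨k - 1, hik, by omega⟩
  refine ⟨Nat.findGreatest (fun j => d j ≠ 3) i, Nat.find hex, ?_, (Nat.find_spec hex).1,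
    (Nat.find_min' hex ⟨hik, by omega⟩).trans_lt (by omega), fun j h1 h2 => ?_, ?_,
    (Nat.find_spec hex).2⟩
  · refine lt_of_le_of_ne (Nat.findGreatest_le i) fun h => ?_
    exact (Nat.findGreatest_eq_iff.1 h).2.1 (by omega) h3
  · by_contra hj
    rcases le_or_gt j i with h | h
    · exact Nat.findGreatest_is_greatest h1 h hj
    · exact Nat.find_min hex h2 ⟨h, hj⟩
  · exact Nat.findGreatest_spec (P := fun j => d j ≠ 3) (m := 0) (Nat.zero_le _) (by omega)

/-- The value at an index of a block of terms equal to `3`, in terms of the distances to the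
indices `p` and `q` just outside of the block. -/
theorem baseValue_eq {p q i : ℕ} (hd : IsPathSequence (term s) s.length)
    (h3 : ∀ j, p < j → j < q → term s j = 3) (hpi : p < i)
    (hiq : i < q) (hp : term s p ≠ 3) (hq : term s q ≠ 3) (hqs : q < s.length) :
    (term s p = 1 ∧ term s q = 1 ∧ baseValue s i = min (i - p) (q - i)) ∨
    (term s p = 2 ∧ term s q = 2 ∧ baseValue s i = max (i - p) (q - i)) ∨
    (term s p = 1 ∧ term s q = 2 ∧ baseValue s i = i - p) ∨
    (term s p = 2 ∧ term s q = 1 ∧ baseValue s i = q - i) ∨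
    (term s p = 1 ∧ term s q = 4 ∧ baseValue s i = min (i - p) (q + 1 - i)) ∨
    (term s p = 4 ∧ term s q = 1 ∧ baseValue s i = min (i + 1 - p) (q - i)) ∨
    (term s p = 4 ∧ term s q = 2 ∧ baseValue s i = i + 1 - p) ∨
    (term s p = 2 ∧ term s q = 4 ∧ baseValue s i = q + 1 - i) ∨
    (term s p = 4 ∧ term s q = 4 ∧ baseValue s i = min (i + 1 - p) (q + 1 - i)) := by
  have hp' : term s p = 1 ∨ term s p = 2 ∨ term s p = 4 := by
    rcases Nat.eq_zero_or_pos p with rfl | h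
    · exact Or.inl hd.zero
    · have := hd.inner p h (by omega)
      omega
  have hq' : term s q = 1 ∨ term s q = 2 ∨ term s q = 4 := by
    rcases (show q ≤ s.length - 1 by omega).eq_or_lt with rfl | h
    · exact Or.inl hd.last
    · have := hd.inner q (by omega) (by omega)
      omega
  have hb : baseValue s i = blockValue s i := by simp only [baseValue, h3 i hpi hiq]
  rw [hb]
  have hqq : q - 1 + 1 = q := by omega
  rcases hp' with ha | ha | ha <;> rcases hq' with hb | hb | hb <;>
    simp [blockValue, first_eq h3 hpi hiq hp, last_eq h3 hpi hiq hq hqs, hqq, ha, hb] <;>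
    omega

theorem IsTimeSequence.le_baseValue {τ : ℕ → ℕ} (hd : IsPathSequence (term s) s.length)
    (hτ : IsTimeSequence (term s) s.length τ) {i : ℕ} (hi : i < s.length) (h2 : term s i ≠ 2) :
    τ i ≤ baseValue s i := by
  rcases Nat.eq_zero_or_pos i with rfl | h0
  · simp [hτ.zero]
  rcases (show i ≤ s.length - 1 by omega).eq_or_lt with rfl | hl
  · simp [hτ.last]
  rcases hd.inner i h0 (by omega) with h | h | h
  · exact absurd h h2
  · obtain ⟨p, q, hpi, hiq, hq, h3, hp3, hq3⟩ := hd.exists_block hi h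
    have hl := hτ.le_add_left hq h3 (i - p) (by omega)
    have hr := hτ.le_add_right hq h3 (q - i) i hpi (by omega)
    rw [Nat.add_sub_cancel' hpi.le] at hl
    have hp1 : term s p = 1 → τ p = 0 := fun h1 => by
      rcases Nat.eq_zero_or_pos p with rfl | h
      · exact hτ.zero
      · have := hd.inner p h (by omega)
        omega
    have hq1 : term s q = 1 → τ q = 0 := fun h1 => by
      rcases (show q ≤ s.length - 1 by omega).eq_or_lt with rfl | h
      · exact hτ.last
      · have := hd.inner q (by omega) (by omega)
        omega
    have hp0 : term s p ≠ 1 → 0 < p := fun h1 =>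
      Nat.pos_of_ne_zero (by rintro rfl; exact h1 hd.zero)
    have hqk : term s q ≠ 1 → q + 1 < s.length := fun h1 => by
      have : q ≠ s.length - 1 := by rintro rfl; exact h1 hd.last
      omega
    have hp4 : term s p = 4 → τ p ≤ 1 := fun h1 =>
      hτ.four p (hp0 (by omega)) (by omega) h1
    have hq4 : term s q = 4 → τ q ≤ 1 := fun h1 =>
      hτ.four q (by omega) (hqk (by omega)) h1
    have h22 : term s p = 2 → term s q = 2 → τ i ≤ max (i - p) (q - i) := fun h1 h2 =>
      hτ.block_two_two (hp0 (by omega)) (hqk (by omega)) h3 h1 h2 hpi hiq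
    -- The time of a 2 at an end is not bounded in advance, so the bound then comes from the
    -- opposite end, or from `h22`.
    rcases baseValue_eq hd h3 hpi hiq hp3 hq3 hq with
      h | h | h | h | h | h | h | h | h <;> omega
  · have := hτ.four i h0 (by omega) h
    simpa [baseValue, h] using this

theorem mem_one_two_iff (a : ℕ) : a ∈ ({1, 2} : Finset ℕ) ↔ a = 1 ∨ a = 2 := by simp

theorem IsTimeSequence.le_value {τ : ℕ → ℕ} (hd : IsPathSequence (term s) s.length)
    (hτ : IsTimeSequence (term s) s.length τ) {i : ℕ} (hi : i < s.length) :
    τ i ≤ value s i := by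
  by_cases h2 : term s i = 2
  · rcases Nat.eq_zero_or_pos (τ i) with h | hpos
    · omega
    have h0 : 0 < i := Nat.pos_of_ne_zero (by rintro rfl; have := hd.zero; omega)
    have hl : i ≠ s.length - 1 := by rintro rfl; have := hd.last; omega
    obtain ⟨hlt1, hlt2, hle⟩ := hτ.two i h0 (by omega) h2 hpos
    -- A neighbouring 2 with positive time would have to be later than `i`, while `i` must be later
    -- than it; hence its time is 0.
    have hzero : ∀ j, j < s.length → τ j < τ i →
        (0 < j → j + 1 < s.length → term s j = 2 → 0 < τ j → τ i < τ j) → term s j = 1 ∨ term s j = 2 → τ j = 0 := by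
      intro j hj hlt himp h12
      rcases Nat.eq_zero_or_pos j with rfl | hj0
      · exact hτ.zero
      rcases (show j ≤ s.length - 1 by omega).eq_or_lt with rfl | hj1
      · exact hτ.last
      have := hd.inner j hj0 (by omega)
      by_contra hne
      have := himp hj0 (by omega) (by omega) (by omega)
      omega
    have hA := hzero (i - 1) (by omega) hlt1 fun a b c e => by
      have := (hτ.two _ a b c e).2.1
      rwa [Nat.sub_add_cancel h0] at this
    have hB := hzero (i + 1) (by omega) hlt2 fun a b c e => (hτ.two _ a b c e).1
    have hA' := hτ.le_baseValue hd (i := i - 1) (by omega)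
    have hB' := hτ.le_baseValue hd (i := i + 1) (by omega)
    simp only [value, h2, mem_one_two_iff, if_true]
    split_ifs with h3 h4 h4
    · have := hA h3; have := hB h4; omega
    · have := hA h3; have := hB' (by tauto); omega
    · have := hB h4; have := hA' (by tauto); omega
    · have := hA' (by tauto); have := hB' (by tauto); omega
  · rw [value, if_neg h2]
    exact hτ.le_baseValue hd hi h2

/-- Some time sequence exceeds `baseValue s i` at the index after `i`, if the term there is `2`. -/
theorem exists_isTimeSequence_right (hd : IsPathSequence (term s) s.length) {i : ℕ}
    (hi : i + 1 < s.length) (h2 : term s (i + 1) = 2) (h34 : term s i = 3 ∨ term s i = 4) :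
    ∃ τ, IsTimeSequence (term s) s.length τ ∧ baseValue s i + 1 ≤ τ (i + 1) := by
  rcases h34 with h | h
  · obtain ⟨p, q, hpi, hiq, hq, h3, hp3, hq3⟩ := hd.exists_block (by omega) h
    obtain rfl : q = i + 1 := by
      by_contra hne
      have := h3 (i + 1) (by omega) (by omega)
      omega
    -- Here `i` is the last index of the block, so `q - i = 1 ≤ i - p` and the maximum in the case
    -- of two 2s is `i - p`.
    have hb := baseValue_eq hd h3 hpi hiq hp3 hq3 hq
    by_cases h4 : term s p = 4
    · refine ⟨_, isTimeSequence_right hd (by omega) hq h3 (Or.inr ⟨rfl, h4⟩) h2, ?_⟩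
      simp only [if_pos (show p ≤ i + 1 ∧ i + 1 ≤ i + 1 by omega)]
      omega
    · refine ⟨_, isTimeSequence_right hd (by omega) hq h3 (Or.inl rfl) h2, ?_⟩
      simp only [if_pos (show p ≤ i + 1 ∧ i + 1 ≤ i + 1 by omega)]
      omega
  · refine ⟨_, isTimeSequence_right hd (p := i) (by omega) hi (by omega) (Or.inr ⟨rfl, h⟩) h2, ?_⟩
    simp only [if_pos (show i ≤ i + 1 ∧ i + 1 ≤ i + 1 by omega), baseValue, h]
    omega

theorem exists_isTimeSequence_left (hd : IsPathSequence (term s) s.length) {i : ℕ}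
    (hi : i + 1 < s.length) (h2 : term s i = 2)
    (h34 : term s (i + 1) = 3 ∨ term s (i + 1) = 4) :
    ∃ τ, IsTimeSequence (term s) s.length τ ∧ baseValue s (i + 1) + 1 ≤ τ i := by
  rcases h34 with h | h
  · obtain ⟨p, q, hpi, hiq, hq, h3, hp3, hq3⟩ := hd.exists_block (by omega) h
    obtain rfl : p = i := by
      by_contra hne
      have := h3 i (by omega) (by omega)
      omega
    have hb := baseValue_eq hd h3 hpi hiq hp3 hq3 hq
    by_cases h4 : term s q = 4
    · refine ⟨_, isTimeSequence_left hd (by omega) hq h3 (Or.inr ⟨rfl, h4⟩) h2, ?_⟩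
      simp only [if_pos (show p ≤ p ∧ p ≤ q by omega)]
      omega
    · refine ⟨_, isTimeSequence_left hd (by omega) hq h3 (Or.inl rfl) h2, ?_⟩
      simp only [if_pos (show p ≤ p ∧ p ≤ q by omega)]
      omega
  · refine ⟨_, isTimeSequence_left hd (p := i) (by omega) hi (by omega) (Or.inr ⟨rfl, h⟩) h2, ?_⟩
    simp only [if_pos (show i ≤ i ∧ i ≤ i + 1 by omega), baseValue, h]
    omega

theorem exists_baseValue_le (hd : IsPathSequence (term s) s.length) {i : ℕ} (hi : i < s.length)
    (h2 : term s i ≠ 2) :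
    ∃ τ, IsTimeSequence (term s) s.length τ ∧ baseValue s i ≤ τ i := by
  have hzero : IsTimeSequence (term s) s.length 0 := by constructor <;> simp
  by_cases h1 : term s i = 1
  · exact ⟨0, hzero, by simp [baseValue, h1]⟩
  have h0 : 0 < i := Nat.pos_of_ne_zero (by rintro rfl; exact h1 hd.zero)
  have hl : i ≠ s.length - 1 := by rintro rfl; exact h1 hd.last
  rcases hd.inner i h0 (by omega) with h | h | h
  · exact absurd h h2
  · obtain ⟨p, q, hpi, hiq, hq, h3, hp3, hq3⟩ := hd.exists_block hi h
    obtain ⟨α, hα, hα4⟩ : ∃ α, (α = 0 ∨ α = 1 ∧ term s p = 4) ∧ (term s p = 4 → α = 1) := by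
      by_cases h4 : term s p = 4
      · exact ⟨1, by simp [h4], by simp⟩
      · exact ⟨0, by simp, fun h => absurd h h4⟩
    obtain ⟨β, hβ, hβ4⟩ : ∃ β, (β = 0 ∨ β = 1 ∧ term s q = 4) ∧ (term s q = 4 → β = 1) := by
      by_cases h4 : term s q = 4
      · exact ⟨1, by simp [h4], by simp⟩
      · exact ⟨0, by simp, fun h => absurd h h4⟩
    have hb := baseValue_eq hd h3 hpi hiq hp3 hq3 hq
    have hpq : p ≤ i ∧ i ≤ q := by omega
    -- A ramp climbs towards a 2; if both ends are 2s, it starts from the end farther from `i`.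
    -- Without a 2, a tent is used.
    by_cases hq2 : term s q = 2 ∧ (term s p = 2 → q - i ≤ i - p)
    · refine ⟨_, isTimeSequence_right hd (by omega) hq h3 hα hq2.1, ?_⟩
      simp only [if_pos hpq]
      omega
    · by_cases hp2 : term s p = 2
      · refine ⟨_, isTimeSequence_left hd (by omega) hq h3 hβ hp2, ?_⟩
        simp only [if_pos hpq]
        omega
      · refine ⟨_, isTimeSequence_min hd (by omega) hq h3 hα hβ, ?_⟩
        simp only [if_pos hpq]
        omega
  · refine ⟨fun j => if j = i then 1 else 0, ?_, by simp [baseValue, h]⟩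
    constructor <;> grind

theorem exists_value_le (hd : IsPathSequence (term s) s.length) {i : ℕ} (hi : i < s.length) :
    ∃ τ, IsTimeSequence (term s) s.length τ ∧ value s i ≤ τ i := by
  by_cases h2 : term s i = 2
  · have h0 : 0 < i := Nat.pos_of_ne_zero (by rintro rfl; have := hd.zero; omega)
    have hl : i ≠ s.length - 1 := by rintro rfl; have := hd.last; omega
    obtain ⟨i, rfl⟩ : ∃ l, i = l + 1 := ⟨i - 1, by omega⟩
    have hA : ¬ (term s i = 1 ∨ term s i = 2) → term s i = 3 ∨ term s i = 4 := by
      rcases Nat.eq_zero_or_pos i with rfl | hj0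
      · simp [hd.zero]
      · have := hd.inner i hj0 (by omega)
        omega
    have hB : ¬ (term s (i + 1 + 1) = 1 ∨ term s (i + 1 + 1) = 2) →
        term s (i + 1 + 1) = 3 ∨ term s (i + 1 + 1) = 4 := by
      rcases (show i + 1 + 1 ≤ s.length - 1 by omega).eq_or_lt with h | hj1
      · simp [h, hd.last]
      · have := hd.inner (i + 1 + 1) (by omega) (by omega)
        omega
    simp only [value, h2, mem_one_two_iff, if_true, Nat.add_sub_cancel]
    split_ifs with h3 h4 h4
    -- A ramp with an empty block, from 0 to 1, suffices for a 2 next to leaves or 2s.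
    · refine ⟨_, isTimeSequence_right hd (p := i) (by omega) hi (by omega) (Or.inl rfl) h2, ?_⟩
      simp
    · exact exists_isTimeSequence_left hd (by omega) h2 (hB h4)
    · exact exists_isTimeSequence_right hd (by omega) h2 (hA h3)
    · rcases le_total (baseValue s i) (baseValue s (i + 1 + 1)) with h | h
      · rw [max_eq_right h]
        exact exists_isTimeSequence_left hd (by omega) h2 (hB h4)
      · rw [max_eq_left h]
        exact exists_isTimeSequence_right hd (by omega) h2 (hA h3)
  · rw [value, if_neg h2]
    exact exists_baseValue_le hd hi h2

end PercolationSequence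

/-! ### Transfer between the caterpillar and its path -/

section LeafDominatingPath

open PercolationSequence

variable {V : Type*} {T : SimpleGraph V} {a b : V} {P : T.Walk a b}

theorem SimpleGraph.IsAcyclic.eq_getVert_of_adj (hT : T.IsAcyclic) (hP : P.IsPath) {i : ℕ} {u : V}
    (hi : i ≤ P.length) (hadj : T.Adj (P.getVert i) u) (hu : u ∈ P.support) :
    u = P.getVert (i - 1) ∨ u = P.getVert (i + 1) := by
  obtain ⟨j, rfl, hj⟩ := SimpleGraph.Walk.mem_support_iff_exists_getVert.1 hu
  rcases le_total i j with h | h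
  · right
    have hmem : P.getVert j ∈ (P.drop i).support := by
      have := (P.drop i).getVert_mem_support (j - i)
      rwa [SimpleGraph.Walk.drop_getVert, Nat.add_sub_cancel' h] at this
    rw [hT.eq_snd_of_adj_start (hP.drop i) hadj hmem, SimpleGraph.Walk.snd,
      SimpleGraph.Walk.drop_getVert]
  · left
    have hmem : P.getVert j ∈ (P.take i).support := by
      have := (P.take i).getVert_mem_support j
      rwa [SimpleGraph.Walk.take_getVert, min_eq_right h] at this
    rw [hT.eq_penultimate_of_adj_end (hP.take i) hadj hmem, SimpleGraph.Walk.penultimate,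
      SimpleGraph.Walk.take_getVert, SimpleGraph.Walk.take_length]
    congr 1
    omega

/-- Every edge is a bridge. A second neighbour `w'` lies on the path or is adjacent to a path
vertex, so it could be joined to `w` without using the edge `uw`. -/
theorem SimpleGraph.IsAcyclic.eq_of_adj_of_notMem_support (hT : T.IsAcyclic)
    (hdom : ∀ v, v ∉ P.support → ∃ w ∈ P.support, T.Adj v w) {u w w' : V} (hu : u ∉ P.support)
    (hw : w ∈ P.support) (huw : T.Adj u w) (huw' : T.Adj u w') : w' = w := by
  classical
  by_contra hne
  obtain ⟨q, hq⟩ : ∃ q : T.Walk w' w, s(u, w) ∉ q.edges := by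
    have key : ∀ x (hx : x ∈ P.support), ∃ q : T.Walk x w, s(u, w) ∉ q.edges := fun x hx => by
      refine ⟨(P.takeUntil x hx).reverse.append (P.takeUntil w hw), fun h => hu ?_⟩
      have := SimpleGraph.Walk.fst_mem_support_of_mem_edges _ h
      rw [SimpleGraph.Walk.mem_support_append_iff, SimpleGraph.Walk.support_reverse,
        List.mem_reverse] at this
      rcases this with h | h
      · exact P.support_takeUntil_subset_support hx h
      · exact P.support_takeUntil_subset_support hw h
    by_cases hw' : w' ∈ P.support
    · exact key w' hw'
    · obtain ⟨x, hx, hadj⟩ := hdom w' hw'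
      obtain ⟨q, hq⟩ := key x hx
      refine ⟨SimpleGraph.Walk.cons hadj q, fun h => ?_⟩
      rw [SimpleGraph.Walk.edges_cons, List.mem_cons] at h
      rcases h with h | h
      · rw [Sym2.eq_iff] at h
        rcases h with ⟨h, -⟩ | ⟨h, -⟩
        · exact huw'.ne h
        · exact hu (h ▸ hx)
      · exact hq h
  have := (SimpleGraph.isBridge_iff_forall_walk_mem_edges.1
    (SimpleGraph.isAcyclic_iff_forall_adj_isBridge.1 hT huw)) (SimpleGraph.Walk.cons huw' q)
  rw [SimpleGraph.Walk.edges_cons, List.mem_cons] at this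
  rcases this with h | h
  · rw [Sym2.eq_iff] at h
    rcases h with ⟨-, h⟩ | ⟨-, h⟩
    · exact hne h.symm
    · exact huw.ne h.symm
  · exact hq h

theorem IsTimeFunction.eq_zero {t : V → ℕ} (ht : IsTimeFunction T t) {v w : V}
    (h : ∀ u, T.Adj v u → u = w) : t v = 0 := by
  by_contra hne
  obtain ⟨x, y, hxy, hx, hy, -, -⟩ := (ht v (Nat.pos_of_ne_zero hne)).1
  exact hxy ((h x hx).trans (h y hy).symm)

theorem IsTimeFunction.eq_zero_of_notMem_support {t : V → ℕ} (ht : IsTimeFunction T t)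
    (hT : T.IsAcyclic) (hdom : ∀ v, v ∉ P.support → ∃ w ∈ P.support, T.Adj v w) {v : V}
    (hv : v ∉ P.support) : t v = 0 := by
  obtain ⟨w, hw, hvw⟩ := hdom v hv
  exact ht.eq_zero fun _ hu => hT.eq_of_adj_of_notMem_support hdom hv hw hvw hu

variable [Fintype V] [DecidableRel T.Adj]

theorem IsTimeFunction.eq_zero_of_degree {t : V → ℕ} (ht : IsTimeFunction T t) {v : V}
    (hv : T.degree v = 1) : t v = 0 := by
  obtain ⟨w, hw⟩ := Finset.card_eq_one.1 hv
  refine ht.eq_zero (w := w) fun u hu => ?_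
  rwa [← SimpleGraph.mem_neighborFinset, hw, Finset.mem_singleton] at hu

theorem length_reducedDegreeSequence : (reducedDegreeSequence T P).length = P.length + 1 := by
  simp [reducedDegreeSequence]

theorem term_reducedDegreeSequence {i : ℕ} (hi : i ≤ P.length) :
    term (reducedDegreeSequence T P) i = min (T.degree (P.getVert i)) 4 := by
  have h : i < P.support.length := by rw [P.length_support]; omega
  rw [P.getVert_eq_support_getElem hi]
  simp [term, reducedDegreeSequence, List.getD_eq_getElem?_getD, List.getElem?_eq_getElem h]

theorem SimpleGraph.IsAcyclic.exists_neighbors_getVert (hT : T.IsAcyclic) (hP : P.IsPath) {i : ℕ}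
    (h0 : 0 < i) (hi : i < P.length) :
    P.getVert (i - 1) ≠ P.getVert (i + 1) ∧ ∃ E : Finset V,
      E.card + 2 = T.degree (P.getVert i) ∧ (∀ u ∈ E, u ∉ P.support) ∧
      ∀ u, T.Adj (P.getVert i) u ↔ u = P.getVert (i - 1) ∨ u = P.getVert (i + 1) ∨ u ∈ E := by
  classical
  have hne : P.getVert (i - 1) ≠ P.getVert (i + 1) := fun h => by
    have := hP.getVert_injOn (show i - 1 ≤ P.length by omega) (show i + 1 ≤ P.length by omega) h
    omega
  have hz : T.Adj (P.getVert i) (P.getVert (i + 1)) := P.adj_getVert_succ hi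
  have hy : T.Adj (P.getVert i) (P.getVert (i - 1)) := by
    have := P.adj_getVert_succ (i := i - 1) (by omega)
    rw [Nat.sub_add_cancel h0] at this
    exact this.symm
  have hiff : ∀ u, T.Adj (P.getVert i) u ↔ u = P.getVert (i - 1) ∨ u = P.getVert (i + 1) ∨
      u ∈ (T.neighborFinset (P.getVert i)).filter (· ∉ P.support) := fun u => by
    rw [Finset.mem_filter, SimpleGraph.mem_neighborFinset]
    constructor
    · intro hu
      by_cases hs : u ∈ P.support
      · rcases hT.eq_getVert_of_adj hP hi.le hu hs with h | h <;> simp [h]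
      · exact Or.inr (Or.inr ⟨hu, hs⟩)
    · rintro (rfl | rfl | h)
      exacts [hy, hz, h.1]
  refine ⟨hne, _, ?_, fun u hu => (Finset.mem_filter.1 hu).2, hiff⟩
  have : T.neighborFinset (P.getVert i) = insert (P.getVert (i - 1)) (insert (P.getVert (i + 1))
      ((T.neighborFinset (P.getVert i)).filter (· ∉ P.support))) := by
    ext u
    rw [SimpleGraph.mem_neighborFinset, hiff u, Finset.mem_insert, Finset.mem_insert]
  rw [← SimpleGraph.card_neighborFinset_eq_degree]
  conv_rhs => rw [this]
  rw [Finset.card_insert_of_notMem, Finset.card_insert_of_notMem]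
  · simp [P.getVert_mem_support]
  · simp [P.getVert_mem_support, hne]

namespace IsLeafDominatingPath

theorem length_pos (hP : IsLeafDominatingPath T P) : 0 < P.length := by
  rcases Nat.eq_zero_or_pos P.length with h | h
  · exact absurd (SimpleGraph.Walk.eq_of_length_eq_zero h) hP.2.1
  · exact h

theorem isPathSequence (hT : T.IsAcyclic) (hP : IsLeafDominatingPath T P) :
    IsPathSequence (term (reducedDegreeSequence T P)) (reducedDegreeSequence T P).length := by
  have hpos := hP.length_pos
  rw [length_reducedDegreeSequence]
  refine ⟨by omega, ?_, ?_, fun i h0 hi => ?_⟩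
  · rw [term_reducedDegreeSequence (Nat.zero_le _), P.getVert_zero, hP.2.2.1]
    rfl
  · rw [Nat.add_sub_cancel, term_reducedDegreeSequence le_rfl, P.getVert_length, hP.2.2.2.1]
    rfl
  · rw [term_reducedDegreeSequence (by omega)]
    obtain ⟨-, E, hE, -⟩ := hT.exists_neighbors_getVert hP.1 h0 (show i < P.length by omega)
    omega

theorem isTimeSequence (hT : T.IsAcyclic) (hP : IsLeafDominatingPath T P) {t : V → ℕ}
    (ht : IsTimeFunction T t) :
    IsTimeSequence (term (reducedDegreeSequence T P)) (reducedDegreeSequence T P).length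
      (fun i => t (P.getVert i)) := by
  rw [length_reducedDegreeSequence]
  have hoff : ∀ u, u ∉ P.support → t u = 0 := fun u hu =>
    ht.eq_zero_of_notMem_support hT hP.2.2.2.2 hu
  constructor
  · simpa using ht.eq_zero_of_degree hP.2.2.1
  · simpa using ht.eq_zero_of_degree hP.2.2.2.1
  · intro i h0 hi hd hpos
    rw [term_reducedDegreeSequence (by omega)] at hd
    obtain ⟨hne, E, hE, -, hadj⟩ :=
      hT.exists_neighbors_getVert hP.1 h0 (show i < P.length by omega)
    obtain rfl : E = ∅ := Finset.card_eq_zero.1 (by omega)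
    simp only [Finset.notMem_empty, or_false] at hadj
    have hle := (ht _ hpos).2 _ _ hne ((hadj _).2 (Or.inl rfl)) ((hadj _).2 (Or.inr rfl))
    obtain ⟨u, w, huw, hu, hw, h1, h2⟩ := (ht _ hpos).1
    rcases (hadj u).1 hu with rfl | rfl <;> rcases (hadj w).1 hw with rfl | rfl
    exacts [absurd rfl huw, ⟨h1, h2, hle⟩, ⟨h2, h1, hle⟩, absurd rfl huw]
  · intro i h0 hi hd hpos
    rw [term_reducedDegreeSequence (by omega)] at hd
    obtain ⟨hne, E, hE, hEs, hadj⟩ :=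
      hT.exists_neighbors_getVert hP.1 h0 (show i < P.length by omega)
    obtain ⟨l, rfl⟩ := Finset.card_eq_one.1 (show E.card = 1 by omega)
    simp only [Finset.mem_singleton, forall_eq] at hadj hEs
    have hl := hoff l hEs
    have hly := (ht _ hpos).2 (P.getVert (i - 1)) l (fun h => hEs (h ▸ P.getVert_mem_support _))
      ((hadj _).2 (by simp)) ((hadj _).2 (by simp))
    have hlz := (ht _ hpos).2 (P.getVert (i + 1)) l (fun h => hEs (h ▸ P.getVert_mem_support _))
      ((hadj _).2 (by simp)) ((hadj _).2 (by simp))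
    refine ⟨?_, by omega, by omega⟩
    obtain ⟨u, w, huw, hu, hw, h1, h2⟩ := (ht _ hpos).1
    rcases (hadj u).1 hu with rfl | rfl | rfl
    · exact Or.inl h1
    · exact Or.inr h1
    · rcases (hadj w).1 hw with rfl | rfl | rfl
      exacts [Or.inl h2, Or.inr h2, absurd rfl huw]
  · intro i h0 hi hd
    rw [term_reducedDegreeSequence (by omega)] at hd
    obtain ⟨hne, E, hE, hEs, hadj⟩ :=
      hT.exists_neighbors_getVert hP.1 h0 (show i < P.length by omega)
    obtain ⟨u, hu, w, hw, huw⟩ := Finset.one_lt_card.1 (show 1 < E.card by omega)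
    rcases Nat.eq_zero_or_pos (t (P.getVert i)) with h | hpos
    · simp [h]
    have := (ht _ hpos).2 u w huw ((hadj _).2 (by simp [hu])) ((hadj _).2 (by simp [hw]))
    rwa [hoff u (hEs u hu), hoff w (hEs w hw)] at this

theorem exists_isTimeFunction (hT : T.IsAcyclic) (hP : IsLeafDominatingPath T P) {τ : ℕ → ℕ}
    (hτ : IsTimeSequence (term (reducedDegreeSequence T P))
      (reducedDegreeSequence T P).length τ) :
    ∃ t, IsTimeFunction T t ∧ ∀ i ≤ P.length, t (P.getVert i) = τ i := by
  classical
  rw [length_reducedDegreeSequence] at hτ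
  obtain ⟨t, ht, hoff⟩ : ∃ t : V → ℕ, (∀ i ≤ P.length, t (P.getVert i) = τ i) ∧
      ∀ v, v ∉ P.support → t v = 0 := by
    refine ⟨fun v => if v ∈ P.support then τ (P.support.idxOf v) else 0, fun i hi => ?_,
      fun v hv => by simp [hv]⟩
    simp only [P.getVert_mem_support, if_true]
    rw [P.getVert_eq_support_getElem hi, List.Nodup.idxOf_getElem hP.1.support_nodup]
  refine ⟨t, fun v hpos => ?_, ht⟩
  have hv : v ∈ P.support := by
    by_contra h
    have := hoff v h
    omega
  obtain ⟨i, rfl, hi⟩ := SimpleGraph.Walk.mem_support_iff_exists_getVert.1 hv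
  have h0 : 0 < i := Nat.pos_of_ne_zero (by rintro rfl; rw [ht 0 hi, hτ.zero] at hpos; omega)
  have hl : i ≠ P.length := by
    rintro rfl
    have := hτ.last
    rw [ht _ hi] at hpos
    simp at this
    omega
  obtain ⟨hne, E, hE, hEs, hadj⟩ :=
    hT.exists_neighbors_getVert hP.1 h0 (show i < P.length by omega)
  have hd := term_reducedDegreeSequence hi
  have hi1 := ht (i - 1) (by omega)
  have hi2 := ht (i + 1) (by omega)
  rw [ht i hi] at hpos ⊢
  rcases (isPathSequence hT hP).inner i h0 (by rw [length_reducedDegreeSequence]; omega)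
    with h | h | h
  · obtain rfl : E = ∅ := Finset.card_eq_zero.1 (by omega)
    simp only [Finset.notMem_empty, or_false] at hadj
    obtain ⟨h1, h2, h3⟩ := hτ.two i h0 (by omega) h hpos
    refine ⟨⟨_, _, hne, (hadj _).2 (Or.inl rfl), (hadj _).2 (Or.inr rfl), by omega, by omega⟩, ?_⟩
    intro u w huw hu hw
    rcases (hadj u).1 hu with rfl | rfl <;> rcases (hadj w).1 hw with rfl | rfl <;>
      first | exact absurd rfl huw | omega
  · obtain ⟨l, rfl⟩ := Finset.card_eq_one.1 (show E.card = 1 by omega)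
    simp only [Finset.mem_singleton, forall_eq] at hadj hEs
    have hl := hoff l hEs
    have hnl : ∀ j, P.getVert j ≠ l := fun j h => hEs (h ▸ P.getVert_mem_support _)
    obtain ⟨h1, h2, h3⟩ := hτ.three i h0 (by omega) h hpos
    constructor
    · rcases h1 with h1 | h1
      · exact ⟨_, _, hnl _, (hadj _).2 (Or.inl rfl), (hadj _).2 (by simp), by omega, by omega⟩
      · exact ⟨_, _, hnl _, (hadj _).2 (Or.inr (Or.inl rfl)), (hadj _).2 (by simp), by omega,
          by omega⟩
    · intro u w huw hu hw
      rcases (hadj u).1 hu with rfl | rfl | rfl <;> rcases (hadj w).1 hw with rfl | rfl | rfl <;>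
        first | exact absurd rfl huw | omega
  · obtain ⟨u, hu, w, hw, huw⟩ := Finset.one_lt_card.1 (show 1 < E.card by omega)
    have := hτ.four i h0 (by omega) h
    have := hoff u (hEs u hu)
    have := hoff w (hEs w hw)
    exact ⟨⟨u, w, huw, (hadj _).2 (by simp [hu]), (hadj _).2 (by simp [hw]), by omega, by omega⟩,
      fun _ _ _ _ _ => by omega⟩

theorem percolationTime_eq (hT : T.IsAcyclic) (hP : IsLeafDominatingPath T P) :
    percolationTime T = maxValue (reducedDegreeSequence T P) := by
  refine le_antisymm (percolationTime_le fun t ht v => ?_) (Finset.sup_le fun i hi => ?_)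
  · by_cases hv : v ∈ P.support
    · obtain ⟨i, rfl, hi⟩ := SimpleGraph.Walk.mem_support_iff_exists_getVert.1 hv
      have hi' : i < (reducedDegreeSequence T P).length := by
        rw [length_reducedDegreeSequence]; omega
      exact ((hP.isTimeSequence hT ht).le_value (hP.isPathSequence hT) hi').trans
        (Finset.le_sup (f := value (reducedDegreeSequence T P)) (Finset.mem_range.2 hi'))
    · rw [ht.eq_zero_of_notMem_support hT hP.2.2.2.2 hv]
      exact Nat.zero_le _
  · rw [Finset.mem_range] at hi
    obtain ⟨τ, hτ, hle⟩ := exists_value_le (hP.isPathSequence hT) hi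
    obtain ⟨t, ht, hti⟩ := hP.exists_isTimeFunction hT hτ
    rw [length_reducedDegreeSequence] at hi
    rw [← hti i (by omega)] at hle
    exact hle.trans (ht.le_percolationTime _)

end IsLeafDominatingPath

end LeafDominatingPath

/-! ### Existence of a leaf dominating path -/

section Existence

variable {V : Type*} [Fintype V] {T : SimpleGraph V} [DecidableRel T.Adj]

theorem SimpleGraph.eq_of_adj_of_degree_eq_one {v u w : V} (hv : T.degree v = 1) (hu : T.Adj v u)
    (hw : T.Adj v w) : u = w :=
  Finset.card_le_one.1 hv.le u (by simpa using hu) w (by simpa using hw)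

/-- In a connected graph, a path between distinct leaves through all vertices which are not
leaves is dominating. -/
theorem SimpleGraph.Connected.isLeafDominatingPath (hT : T.Connected) {a b : V}
    {P : T.Walk a b} (hP : P.IsPath) (hab : a ≠ b) (ha : T.degree a = 1) (hb : T.degree b = 1)
    (h : ∀ v, T.degree v ≠ 1 → v ∈ P.support) : IsLeafDominatingPath T P := by
  refine ⟨hP, hab, ha, hb, fun v hv => ?_⟩
  have : Nontrivial V := ⟨a, b, hab⟩
  have hv1 : T.degree v = 1 := by
    by_contra h1
    exact hv (h v h1)
  obtain ⟨w, hw⟩ := (T.degree_pos_iff_exists_adj v).1 (by omega)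
  by_contra! hno
  have hw1 : T.degree w = 1 := by
    by_contra h1
    exact hno w (h w h1) hw
  -- Two adjacent leaves form a whole component, which would then contain the path's start `a`.
  have hclosed : ∀ x (q : T.Walk v x), x = v ∨ x = w := by
    intro x q
    induction q using SimpleGraph.Walk.concatRec with
    | Hnil => exact Or.inl rfl
    | @Hconcat u y z q hyz ih =>
      rcases ih hv hv1 hw hno with rfl | rfl
      · exact Or.inr (T.eq_of_adj_of_degree_eq_one hv1 hyz hw)
      · exact Or.inl (T.eq_of_adj_of_degree_eq_one hw1 hyz hw.symm)
  rcases hclosed a (hT.preconnected v a).some with rfl | rfl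
  · exact hv P.start_mem_support
  · exact hno _ P.start_mem_support hw

theorem SimpleGraph.exists_isPath_of_pathGraph {V : Type*} {T : SimpleGraph V} {n : ℕ}
    (f : SimpleGraph.pathGraph n ↪g T) (h0 : 0 < n) (j : ℕ) (hj : j < n) :
    ∃ P : T.Walk (f ⟨0, h0⟩) (f ⟨j, hj⟩), P.IsPath ∧
      ∀ v, v ∈ P.support ↔ ∃ i : Fin n, i.1 ≤ j ∧ f i = v := by
  induction j with
  | zero =>
    refine ⟨SimpleGraph.Walk.nil, SimpleGraph.Walk.IsPath.nil, fun v => ?_⟩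
    rw [SimpleGraph.Walk.support_nil, List.mem_singleton]
    constructor
    · rintro rfl
      exact ⟨_, le_rfl, rfl⟩
    · rintro ⟨i, hi, rfl⟩
      congr 1
      ext
      simpa using hi
  | succ j ih =>
    obtain ⟨P, hP, hs⟩ := ih (by omega)
    have hadj : T.Adj (f ⟨j, by omega⟩) (f ⟨j + 1, hj⟩) := by
      rw [f.map_adj_iff, SimpleGraph.pathGraph_adj]
      exact Or.inl rfl
    refine ⟨P.concat hadj, hP.concat (fun h => ?_) hadj, fun v => ?_⟩
    · obtain ⟨i, hi, hif⟩ := (hs _).1 h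
      rw [f.injective hif] at hi
      simp at hi
    · rw [SimpleGraph.Walk.support_concat, List.mem_append, List.mem_singleton, hs]
      constructor
      · rintro (⟨i, hi, rfl⟩ | rfl)
        · exact ⟨i, by omega, rfl⟩
        · exact ⟨_, le_rfl, rfl⟩
      · rintro ⟨i, hi, rfl⟩
        rcases hi.eq_or_lt with h | h
        · exact Or.inr (congrArg f (Fin.ext h))
        · exact Or.inl ⟨i, by omega, rfl⟩

/-- If at most one neighbour of a vertex of degree at least two is not a leaf, then
that vertex is adjacent to a leaf. -/
theorem SimpleGraph.exists_adj_leaf {v c : V} (hv : 2 ≤ T.degree v)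
    (hc : ∀ u, T.Adj v u → T.degree u ≠ 1 → u = c) : ∃ u, u ≠ c ∧ T.Adj v u ∧ T.degree u = 1 := by
  obtain ⟨x, hx, y, hy, hxy⟩ := Finset.one_lt_card.1 (show 1 < (T.neighborFinset v).card from hv)
  rw [SimpleGraph.mem_neighborFinset] at hx hy
  by_cases h : x = c
  · exact ⟨y, fun hyc => hxy (h.trans hyc.symm), hy, by
      by_contra h1; exact hxy (h.trans (hc y hy h1).symm)⟩
  · exact ⟨x, h, hx, by by_contra h1; exact h (hc x hx h1)⟩

theorem IsCaterpillar.exists_isLeafDominatingPath [Nontrivial V] (hT : IsCaterpillar T) :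
    ∃ (a b : V) (P : T.Walk a b), IsLeafDominatingPath T P := by
  obtain ⟨hT, n, ⟨e⟩⟩ := hT
  have hconn := hT.connected
  let f : SimpleGraph.pathGraph n ↪g T :=
    e.symm.toEmbedding.trans (SimpleGraph.Embedding.induce _)
  have hf : ∀ v, T.degree v ≠ 1 ↔ ∃ i, f i = v := fun v => by
    constructor
    · intro hv
      exact ⟨e ⟨v, hv⟩, congrArg Subtype.val (e.symm_apply_apply ⟨v, hv⟩)⟩
    · rintro ⟨i, rfl⟩
      exact (e.symm i).2
  rcases Nat.eq_zero_or_pos n with rfl | hn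
  · have h1 : ∀ v, T.degree v = 1 := fun v => by
      by_contra h
      exact ((hf v).1 h).choose.elim0
    obtain ⟨a⟩ := hconn.nonempty
    obtain ⟨b, hab⟩ := (T.degree_pos_iff_exists_adj a).1 (by rw [h1]; omega)
    exact ⟨a, b, hab.toWalk, hconn.isLeafDominatingPath (SimpleGraph.Walk.IsPath.of_adj hab)
      hab.ne (h1 a) (h1 b) fun v hv => absurd (h1 v) hv⟩
  · have hdeg : ∀ i, 2 ≤ T.degree (f i) := fun i => by
      have h1 := (hf (f i)).2 ⟨i, rfl⟩
      have h2 := hconn.preconnected.degree_pos_of_nontrivial (f i)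
      omega
    obtain ⟨P, hP, hs⟩ := SimpleGraph.exists_isPath_of_pathGraph f hn (n - 1) (by omega)
    have hs' : ∀ v, v ∈ P.support ↔ T.degree v ≠ 1 := fun v => by
      rw [hs, hf]
      exact ⟨fun ⟨i, _, h⟩ => ⟨i, h⟩, fun ⟨i, h⟩ => ⟨i, by omega, h⟩⟩
    obtain ⟨a, ha, ha1⟩ : ∃ a, T.Adj (f ⟨0, hn⟩) a ∧ T.degree a = 1 := by
      -- The remainder keeps the index valid when `n = 1`; then there is no non-leaf neighbour and
      -- the choice of `c` is immaterial.
      obtain ⟨a, -, h⟩ := T.exists_adj_leaf (c := f ⟨1 % n, Nat.mod_lt _ hn⟩) (hdeg ⟨0, hn⟩)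
        fun u hu hu1 => by
          obtain ⟨i, rfl⟩ := (hf u).1 hu1
          rw [f.map_adj_iff, SimpleGraph.pathGraph_adj] at hu
          congr 1
          ext
          simp only at hu ⊢
          have := i.2
          rw [Nat.mod_eq_of_lt (by omega)]
          omega
      exact ⟨a, h⟩
    obtain ⟨b, hba, hb, hb1⟩ : ∃ b, b ≠ a ∧ T.Adj (f ⟨n - 1, by omega⟩) b ∧ T.degree b = 1 := by
      rcases (show 1 ≤ n from hn).eq_or_lt with rfl | hn1
      -- For a star all neighbours of the centre are leaves, so `c` may be taken to be `a`, which
      -- yields a second leaf.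
      · refine T.exists_adj_leaf (hdeg _) fun u hu hu1 => ?_
        obtain ⟨i, rfl⟩ := (hf u).1 hu1
        rw [f.map_adj_iff, SimpleGraph.pathGraph_adj] at hu
        simp only at hu
        omega
      · obtain ⟨b, -, hb, hb1⟩ := T.exists_adj_leaf (c := f ⟨n - 2, by omega⟩)
          (hdeg ⟨n - 1, by omega⟩) fun u hu hu1 => by
            obtain ⟨i, rfl⟩ := (hf u).1 hu1
            rw [f.map_adj_iff, SimpleGraph.pathGraph_adj] at hu
            congr 1
            ext
            simp only at hu ⊢
            have := i.2
            omega
        refine ⟨b, ?_, hb, hb1⟩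
        -- A leaf attached to both ends of the spine would have two distinct neighbours.
        rintro rfl
        have := f.injective (T.eq_of_adj_of_degree_eq_one hb1 ha.symm hb.symm)
        simp only [Fin.mk.injEq] at this
        omega
    have hbP : b ∉ P.support := fun h => (hs' b).1 h hb1
    refine ⟨a, b, SimpleGraph.Walk.cons ha.symm (P.concat hb), hconn.isLeafDominatingPath ?_
      hba.symm ha1 hb1 fun v hv => ?_⟩
    · rw [SimpleGraph.Walk.cons_isPath_iff]
      refine ⟨hP.concat hbP hb, fun h => ?_⟩
      rw [SimpleGraph.Walk.support_concat, List.mem_append, List.mem_singleton] at h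
      rcases h with h | h
      · exact (hs' a).1 h ha1
      · exact hba h.symm
    · rw [SimpleGraph.Walk.support_cons, List.mem_cons, SimpleGraph.Walk.support_concat,
        List.mem_append, List.mem_singleton]
      exact Or.inr (Or.inl ((hs' v).2 hv))

end Existence

theorem mainTheorem3 {V : Type*} [Fintype V] [Nontrivial V] (T : SimpleGraph V)
    [DecidableRel T.Adj] (hT : IsCaterpillar T) :
    (∃ (a b : V) (P : T.Walk a b), IsLeafDominatingPath T P) ∧
      ∀ (a b : V) (P : T.Walk a b), IsLeafDominatingPath T P →
        percolationTime T = PercolationSequence.maxValue (reducedDegreeSequence T P) :=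
  ⟨hT.exists_isLeafDominatingPath, fun _ _ _ hP => hP.percolationTime_eq hT.1.isAcyclic⟩
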